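/- Let $\Sigma$ be a finite alphabet and let $X\subset\Sigma^{\mathbb Z}$ be a subshift, i.e. a closed shift-invariant subset; no further assumption is made on $X$. Write $x^i$ for the point $(x,i)\in X\times\mathbb Z$, thought of as the tape $x\in X$ with a head at position $i$. Let $\mathrm{RFA}(X)=\mathrm{RFA}(X,1)$ be the group, under composition, of one-state reversible finite-state automata on $X$ in the moving-head model: the reversible one-state Turing machines on $X$ that never change the tape. That is, $\mathrm{RFA}(X)$ consists of the bijections $T$ of $X\times\mathbb Z$ such that both $T$ and $T^{-1}$ are of the form $x^i\mapsto x^{\,i+m(x_{i+u}\,:\,u\in F)}$ for some finite $F\subset\mathbb Z$ and some $m\colon\Sigma^F\to\mathbb Z$. An element $T\in\mathrm{RFA}(X)$ is an *orbitwise shift* if for every $x\in X$ there is $k\in\mathbb Z$ with $T(x^i)=x^{i-k}$ for all $i\in\mathbb Z$. An element $T\in\mathrm{RFA}(X)$ is a *controlled position swap* if there are words $u,v\in\Sigma^*$ and a letter $a\in\Sigma$ such that for all $x\in X$ and $i\in\mathbb Z$: if the word $uav$ occurs in $x$ with the displayed letter $a$ at position $i$, then $T(x^i)=x^{i+1}$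 and $T(x^{i+1})=x^i$; and $T(x^i)=x^i$ whenever $uav$ occurs in $x$ with the displayed $a$ neither at position $i$ nor at position $i-1$. **Theorem.** For every subshift $X\subset\Sigma^{\mathbb Z}$, the group $\mathrm{RFA}(X)$ is generated by the orbitwise shifts together with the controlled position swaps. -/

import Mathlib

namespace MovingHead

open SymbolicDynamics.FullShift

variable {A : Type*}

/-- A local rule `f : A^{F_in} × Q → A^{F_out} × Q × ℤ` of a moving-head Turing machine with tape
alphabet `A`, state set `Q = Fin k`, and finite windows `F_in, F_out ⊆ ℤ`. -/
structure LocalRule (A : Type*) (k : ℕ) where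
  inWindow : Finset ℤ
  outWindow : Finset ℤ
  rule : (inWindow → A) × Fin k → (outWindow → A) × Fin k × ℤ

/-- The map `T_f` on triples `(x, q, v)` (tape, state, head position): the pattern around the head
is read, replaced by the first component of the rule, the state is updated to the second component,
and the head moves by the third component. Here `shift v x` is the configuration `u ↦ x (v + u)`. -/
def LocalRule.act {k : ℕ} (f : LocalRule A k) (c : (ℤ → A) × Fin k × ℤ) :
    (ℤ → A) × Fin k × ℤ :=
  let x := c.1
  let q := c.2.1
  let v := c.2.2
  let r := f.rule (fun u => shift v x u, q)
  (fun u => if h : u - v ∈ f.outWindow then r.1 ⟨u - v, h⟩ else x u, r.2.1, v + r.2.2)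

variable [TopologicalSpace A]

/-- The moving-head phase space `X × Q × ℤ` over a subshift `X`, with `Q = Fin k`. -/
abbrev Conf (X : Subshift A ℤ) (k : ℕ) : Type _ := X.carrier × Fin k × ℤ

/-- `T` is a moving-head Turing machine on the subshift `X`: it is the restriction to `X × Q × ℤ`
of the map given by a local rule. -/
def IsMachine (X : Subshift A ℤ) (k : ℕ) (T : Conf X k → Conf X k) : Prop :=
  ∃ f : LocalRule A k, ∀ c : Conf X k,
    (((T c).1 : ℤ → A), (T c).2) = f.act ((c.1 : ℤ → A), c.2)

/-- `T` is a reversible moving-head Turing machine on `X`: it is a machine, and it has a two-sided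
inverse that is a machine. -/
def IsReversibleMachine (X : Subshift A ℤ) (k : ℕ) (T : Equiv.Perm (Conf X k)) : Prop :=
  IsMachine X k T ∧ IsMachine X k T.symm

/-- The machine does not change the tape. -/
def KeepsTape {X : Subshift A ℤ} {k : ℕ} (T : Conf X k → Conf X k) : Prop :=
  ∀ c, (T c).1 = c.1

theorem isMachine_id (X : Subshift A ℤ) (k : ℕ) : IsMachine X k id := by
  refine ⟨⟨∅, ∅, fun p => (fun u => absurd u.2 (Finset.notMem_empty _), p.2, 0)⟩, fun c => ?_⟩
  simp [LocalRule.act]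

theorem IsMachine.comp_of_keepsTape [Finite A] {X : Subshift A ℤ} {k : ℕ}
    {S T : Conf X k → Conf X k} (hS : IsMachine X k S) (hT : IsMachine X k T)
    (kS : KeepsTape S) (kT : KeepsTape T) : IsMachine X k (S ∘ T) := by
  classical
  obtain ⟨g, hg⟩ := hS
  obtain ⟨f, hf⟩ := hT
  have := Fintype.ofFinite A
  let W : Finset ℤ := f.inWindow ∪
    (Finset.univ.image fun p => (f.rule p).2.2).biUnion fun s => g.inWindow.image fun u => s + u
  have hfW : ∀ u ∈ f.inWindow, u ∈ W := fun u hu => Finset.mem_union_left _ hu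
  have hgW : ∀ p, ∀ u ∈ g.inWindow, (f.rule p).2.2 + u ∈ W := fun p u hu =>
    Finset.mem_union_right _ (Finset.mem_biUnion.2
      ⟨_, Finset.mem_image_of_mem _ (Finset.mem_univ p), Finset.mem_image_of_mem _ hu⟩)
  let r₁ : (W → A) × Fin k → Fin k × ℤ := fun p =>
    (f.rule (fun u => p.1 ⟨u, hfW u u.2⟩, p.2)).2
  let r₂ : (W → A) × Fin k → Fin k × ℤ := fun p =>
    (g.rule (fun u => p.1 ⟨(r₁ p).2 + u, hgW _ u u.2⟩, (r₁ p).1)).2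
  refine ⟨⟨W, ∅, fun p => (fun u => absurd u.2 (Finset.notMem_empty _),
    (r₂ p).1, (r₁ p).2 + (r₂ p).2)⟩, fun c => ?_⟩
  have h1 := congrArg Prod.snd (hf c)
  have h2 := congrArg Prod.snd (hg (T c))
  have e1 : (S (T c)).1 = c.1 := (kS _).trans (kT c)
  have e2 : (T c).1 = c.1 := kT c
  simp only [LocalRule.act] at h1 h2
  rw [e2, h1] at h2
  simp only [Function.comp_apply, LocalRule.act]
  rw [e1, h2]
  simp [r₁, r₂, shift, add_assoc]

/-- The group of reversible finite-state automata on the subshift `X` with `k` states: the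
reversible moving-head Turing machines on `X` that do not change the tape, under composition. -/
def RFA [Finite A] (X : Subshift A ℤ) (k : ℕ) : Subgroup (Equiv.Perm (Conf X k)) where
  carrier := {T | IsReversibleMachine X k T ∧ KeepsTape T}
  one_mem' := ⟨⟨isMachine_id X k, isMachine_id X k⟩, fun _ => rfl⟩
  inv_mem' := by
    rintro T ⟨⟨h1, h2⟩, h3⟩
    refine ⟨⟨h2, h1⟩, fun c => ?_⟩
    have h := h3 (T.symm c)
    rw [Equiv.apply_symm_apply] at h
    exact h.symm
  mul_mem' := by
    rintro S T ⟨⟨hS, hS'⟩, kS⟩ ⟨⟨hT, hT'⟩, kT⟩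
    have inv : ∀ R : Equiv.Perm (Conf X k), KeepsTape R → KeepsTape R.symm := fun R hR c => by
      have h := hR (R.symm c)
      rw [Equiv.apply_symm_apply] at h
      exact h.symm
    exact ⟨⟨hS.comp_of_keepsTape hT kS kT, hT'.comp_of_keepsTape hS' (inv T kT) (inv S kS)⟩,
      fun c => (kS _).trans (kT c)⟩

/-- The point `x^i` of the one-state phase space: tape `x`, head at position `i`. -/
def headAt {X : Subshift A ℤ} (x : X.carrier) (i : ℤ) : Conf X 1 := (x, 0, i)

/-- `T` is an orbitwise shift: for every `x ∈ X` there is `k` with `T (x^i) = x^{i-k}` for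
all `i`. -/
def IsOrbitwiseShift [Finite A] {X : Subshift A ℤ} (T : RFA X 1) : Prop :=
  ∀ x : X.carrier, ∃ k : ℤ, ∀ i : ℤ, T.1 (headAt x i) = headAt x (i - k)

/-- The word `w` occurs in `x` starting at position `i`. -/
def ReadsAt (x : ℤ → A) (i : ℤ) (w : List A) : Prop :=
  ∀ n : Fin w.length, x (i + (n : ℕ)) = w.get n

/-- The word `u a v` occurs in `x` with the distinguished letter `a` at position `i`. -/
def Matches (u : List A) (a : A) (v : List A) (x : ℤ → A) (i : ℤ) : Prop :=
  ReadsAt x (i - u.length) (u ++ a :: v)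

/-- `T` is the controlled position swap `T_{u,a,v}`: whenever `u a v` occurs with its letter `a` at
position `i`, the head positions `i` and `i + 1` are exchanged; all other heads stay where
they are. -/
def IsControlledPositionSwapWith [Finite A] {X : Subshift A ℤ} (u : List A) (a : A) (v : List A)
    (T : RFA X 1) : Prop :=
  ∀ (x : X.carrier) (i : ℤ),
    (Matches u a v x i → T.1 (headAt x i) = headAt x (i + 1) ∧ T.1 (headAt x (i + 1)) = headAt x i) ∧
    (¬ Matches u a v x i → ¬ Matches u a v x (i - 1) → T.1 (headAt x i) = headAt x i)

/-- `T` is a controlled position swap, for some control words `u`, `v` and some letter `a`. -/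
def IsControlledPositionSwap [Finite A] {X : Subshift A ℤ} (T : RFA X 1) : Prop :=
  ∃ (u : List A) (a : A) (v : List A), IsControlledPositionSwapWith u a v T

end MovingHead

namespace MovingHead

/-! On each tape `x`, an automaton acts on head positions by a bijection `f` of `ℤ` whose
displacement is bounded by some `D` independent of `x`. Such an `f` can be sorted by adjacent
transpositions, as in bubble sort. Transposing at the first position of every maximal run of
descents gives disjoint swaps selected by a local, shift-invariant rule, so one round is right
multiplication by an element of the group. A round creates no inversion and removes one near every
descent. Bounded displacement confines the relevant inversions to a window of size depending only on
`D`, so a number of rounds uniform in `x` leaves no descent (`not_isDescent_sortStep_iterate`). An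
increasing bijection of `ℤ` is a translation, so the sorted automaton is an orbitwise shift. Each
round is a finite product of controlled position swaps, one per window pattern
(`IsSwapControl.swap_mem_closure`). -/

/-! ### Sorting injective maps `ℤ → ℤ` of bounded displacement by adjacent swaps -/

/-- The map exchanging `i` and `i + 1` whenever `P i` holds. -/
noncomputable def pairSwap (P : ℤ → Prop) (i : ℤ) : ℤ :=
  open Classical in if P i then i + 1 else if P (i - 1) then i - 1 else i

theorem pairSwap_of {P : ℤ → Prop} {i : ℤ} (h : P i) : pairSwap P i = i + 1 := by
  simp [pairSwap, h]

theorem pairSwap_succ {P : ℤ → Prop} (hP : ∀ i, P i → ¬ P (i + 1)) {i : ℤ} (h : P i) :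
    pairSwap P (i + 1) = i := by
  simp [pairSwap, h, hP i h]

theorem pairSwap_of_not {P : ℤ → Prop} {i : ℤ} (h : ¬ P i) (h' : ¬ P (i - 1)) :
    pairSwap P i = i := by
  simp [pairSwap, h, h']

theorem pairSwap_congr {P Q : ℤ → Prop} {i : ℤ} (h : P i ↔ Q i) (h' : P (i - 1) ↔ Q (i - 1)) :
    pairSwap P i = pairSwap Q i := by
  classical
  exact if_congr h rfl (if_congr h' rfl rfl)

theorem pairSwap_cases {P : ℤ → Prop} (hP : ∀ i, P i → ¬ P (i + 1)) (i : ℤ) :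
    (P i ∧ pairSwap P i = i + 1) ∨ (P (i - 1) ∧ pairSwap P i = i - 1) ∨
      (¬ P i ∧ ¬ P (i - 1) ∧ pairSwap P i = i) := by
  by_cases h : P i
  · exact .inl ⟨h, pairSwap_of h⟩
  by_cases h' : P (i - 1)
  · exact .inr (.inl ⟨h', by simpa using pairSwap_succ hP h'⟩)
  · exact .inr (.inr ⟨h, h', pairSwap_of_not h h'⟩)

theorem pairSwap_involutive {P : ℤ → Prop} (hP : ∀ i, P i → ¬ P (i + 1)) :
    Function.Involutive (pairSwap P) := by
  intro i
  rcases pairSwap_cases hP i with ⟨h, e⟩ | ⟨h, e⟩ | ⟨-, -, e⟩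
  · rw [e, pairSwap_succ hP h]
  · rw [e, pairSwap_of h, sub_add_cancel]
  · rw [e, e]

/-- `f` decreases from `i` to `i + 1`. -/
def IsDescent (f : ℤ → ℤ) (i : ℤ) : Prop := f (i + 1) < f i

/-- `i` is the first element of a maximal run of consecutive descents of `f`. -/
def IsRunStart (f : ℤ → ℤ) (i : ℤ) : Prop := IsDescent f i ∧ ¬ IsDescent f (i - 1)

theorem IsRunStart.not_succ {f : ℤ → ℤ} (i : ℤ) (h : IsRunStart f i) : ¬ IsRunStart f (i + 1) :=
  fun h' => h'.2 (by simpa using h.1)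

/-- One round of sorting: exchange the values at `i` and `i + 1` for every run start `i`. -/
noncomputable def sortStep (f : ℤ → ℤ) (i : ℤ) : ℤ := f (pairSwap (IsRunStart f) i)

theorem sortStep_injective {f : ℤ → ℤ} (hf : f.Injective) : (sortStep f).Injective :=
  hf.comp (pairSwap_involutive IsRunStart.not_succ).injective

/-- At a swapped descent, both new displacements lie strictly between the two old ones. -/
theorem abs_sortStep_sub_le {f : ℤ → ℤ} {D : ℤ} (hD : ∀ i, |f i - i| ≤ D) (i : ℤ) :
    |sortStep f i - i| ≤ D := by
  have h0 := abs_le.1 (hD i)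
  unfold sortStep
  rcases pairSwap_cases (IsRunStart.not_succ (f := f)) i with ⟨h, e⟩ | ⟨h, e⟩ | ⟨-, -, e⟩ <;> rw [e]
  · have h1 := abs_le.1 (hD (i + 1))
    have h2 : f (i + 1) < f i := h.1
    exact abs_le.2 (by omega)
  · have h1 := abs_le.1 (hD (i - 1))
    have h2 : f (i - 1 + 1) < f (i - 1) := h.1
    rw [sub_add_cancel] at h2
    exact abs_le.2 (by omega)
  · exact hD i

/-- The values `a < b` occur in the wrong order in `f`. -/
def IsInversion (f : ℤ → ℤ) (a b : ℤ) : Prop := ∃ i j, f i = a ∧ f j = b ∧ j < i ∧ a < b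

theorem IsDescent.isInversion {f : ℤ → ℤ} {i : ℤ} (h : IsDescent f i) :
    IsInversion f (f (i + 1)) (f i) := ⟨i + 1, i, rfl, rfl, by omega, h⟩

/-- Disjoint adjacent swaps alter the relative order of swapped pairs only, and each of these
becomes correctly ordered. Since inversions are indexed by values, they can be compared between
rounds. -/
theorem IsInversion.of_sortStep {f : ℤ → ℤ} {a b : ℤ} (h : IsInversion (sortStep f) a b) :
    IsInversion f a b := by
  obtain ⟨i, j, rfl, rfl, hji, hlt⟩ := h
  refine ⟨_, _, rfl, rfl, ?_, hlt⟩
  have hP := IsRunStart.not_succ (f := f)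
  have inv := pairSwap_involutive hP
  have hne : pairSwap (IsRunStart f) i ≠ pairSwap (IsRunStart f) j := inv.injective.ne hji.ne'
  by_contra hc
  have hi : i - 1 ≤ pairSwap (IsRunStart f) i := by
    rcases pairSwap_cases hP i with ⟨-, e⟩ | ⟨-, e⟩ | ⟨-, -, e⟩ <;> omega
  rcases pairSwap_cases hP j with ⟨k, e⟩ | ⟨-, e⟩ | ⟨-, -, e⟩ <;> try omega
  have hi' : pairSwap (IsRunStart f) i = j := by omega
  have hk : f (j + 1) < f j := k.1
  unfold sortStep at hlt
  rw [hi', e] at hlt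
  omega

theorem IsRunStart.not_isInversion_sortStep {f : ℤ → ℤ} (hf : f.Injective) {i : ℤ}
    (h : IsRunStart f i) : ¬ IsInversion (sortStep f) (f (i + 1)) (f i) := by
  rintro ⟨k, l, hk, hl, hlk, -⟩
  have inv := pairSwap_involutive (IsRunStart.not_succ (f := f))
  have hk' := congrArg (pairSwap (IsRunStart f)) (hf hk)
  have hl' := congrArg (pairSwap (IsRunStart f)) (hf hl)
  rw [inv k, pairSwap_succ IsRunStart.not_succ h] at hk'
  rw [inv l, pairSwap_of h] at hl'
  omega

/-- Along `k` consecutive descents to the left of `i`, the value grows by at least `k` while the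
position drops by `k`, so displacement at most `D` forces `k ≤ D`. -/
theorem exists_isRunStart {f : ℤ → ℤ} {D : ℕ} (hD : ∀ i, |f i - i| ≤ D) {i : ℤ}
    (h : IsDescent f i) : ∃ j, i - D ≤ j ∧ j ≤ i ∧ IsRunStart f j := by
  by_contra! hc
  have key : ∀ k : ℕ, k ≤ D + 1 → IsDescent f (i - k) ∧ f i + k ≤ f (i - k) := by
    intro k
    induction k with
    | zero => intro _; simpa using h
    | succ k ih =>
      intro hk
      obtain ⟨h1, h2⟩ := ih (by omega)
      have h3 : IsDescent f (i - (k + 1 : ℕ)) := by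
        by_contra h4
        refine hc (i - k) (by omega) (by omega) ⟨h1, ?_⟩
        rwa [show i - (k : ℤ) - 1 = i - (k + 1 : ℕ) by push_cast; ring]
      refine ⟨h3, ?_⟩
      have h4 : f (i - (k + 1 : ℕ) + 1) < f (i - (k + 1 : ℕ)) := h3
      rw [show i - ((k + 1 : ℕ) : ℤ) + 1 = i - k by push_cast; ring] at h4
      push_cast at *
      omega
  have h1 := (key (D + 1) le_rfl).2
  have h2 := abs_le.1 (hD i)
  have h3 := abs_le.1 (hD (i - (D + 1 : ℕ)))
  push_cast at *
  omega

theorem exists_isDescent {f : ℤ → ℤ} {i j : ℤ} (hji : j < i) (h : f i < f j) :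
    ∃ k, j ≤ k ∧ k < i ∧ IsDescent f k := by
  by_contra! hc
  have key : ∀ n : ℕ, j + n ≤ i → f j ≤ f (j + n) := by
    intro n
    induction n with
    | zero => simp
    | succ n ih =>
      intro hn
      have h1 := hc (j + n) (by omega) (by omega)
      have h2 := ih (by omega)
      unfold IsDescent at h1
      push_cast
      rw [← add_assoc]
      omega
  have := key (i - j).toNat (by omega)
  rw [Int.toNat_of_nonneg (by omega), add_sub_cancel] at this
  omega

/-- The inversions of `f` among the values at distance at most `K` from `c`. -/
def inversionsNear (K c : ℤ) (f : ℤ → ℤ) : Set (ℤ × ℤ) :=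
  {p | p ∈ Set.Icc (c - K) (c + K) ×ˢ Set.Icc (c - K) (c + K) ∧ IsInversion f p.1 p.2}

theorem finite_inversionsNear (K c : ℤ) (f : ℤ → ℤ) : (inversionsNear K c f).Finite :=
  ((Set.finite_Icc _ _).prod (Set.finite_Icc _ _)).subset fun _ h => h.1

theorem ncard_inversionsNear_le (K c : ℤ) (f : ℤ → ℤ) :
    (inversionsNear K c f).ncard ≤ (2 * K + 1).toNat ^ 2 := by
  refine (Set.ncard_le_ncard (fun _ h => h.1)
    ((Set.finite_Icc _ _).prod (Set.finite_Icc _ _))).trans ?_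
  rw [Set.ncard_prod, ← Finset.coe_Icc, Set.ncard_coe_finset, Int.card_Icc, sq,
    show c + K + 1 - (c - K) = 2 * K + 1 by ring]

/-- The run start `j` lies within `D` to the left of `i`. Thus `j` and `j + 1` are within `L + D +
1` of `c`, and their values within `L + 2 * D + 1`; this pair is the inversion removed. -/
theorem ncard_inversionsNear_sortStep_lt {f : ℤ → ℤ} (hf : f.Injective) {D : ℕ}
    (hD : ∀ i, |f i - i| ≤ D) {L c i : ℤ} (hi : |i - c| ≤ L) (h : IsDescent f i) :
    (inversionsNear (L + 2 * D + 1) c (sortStep f)).ncard <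
      (inversionsNear (L + 2 * D + 1) c f).ncard := by
  obtain ⟨j, hj1, hj2, hj⟩ := exists_isRunStart hD h
  refine Set.ncard_lt_ncard ?_ (finite_inversionsNear _ _ _)
  refine (Set.ssubset_iff_of_subset fun p hp => And.intro hp.1 hp.2.of_sortStep).2
    ⟨(f (j + 1), f j), ⟨?_, hj.1.isInversion⟩, fun hn => hj.not_isInversion_sortStep hf hn.2⟩
  have h1 := abs_le.1 (hD j)
  have h2 := abs_le.1 (hD (j + 1))
  have h3 := abs_le.1 hi
  simp only [Set.mem_prod, Set.mem_Icc]
  omega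

theorem sortStep_iterate_injective {f : ℤ → ℤ} (hf : f.Injective) (n : ℕ) :
    (sortStep^[n] f).Injective := by
  induction n with
  | zero => exact hf
  | succ n ih => rw [Function.iterate_succ_apply']; exact sortStep_injective ih

theorem abs_sortStep_iterate_sub_le {f : ℤ → ℤ} {D : ℤ} (hD : ∀ i, |f i - i| ≤ D) (n : ℕ) :
    ∀ i, |sortStep^[n] f i - i| ≤ D := by
  induction n with
  | zero => exact hD
  | succ n ih => rw [Function.iterate_succ_apply']; exact abs_sortStep_sub_le ih

theorem IsInversion.of_sortStep_iterate {f : ℤ → ℤ} {a b : ℤ} (n : ℕ)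
    (h : IsInversion (sortStep^[n] f) a b) : IsInversion f a b := by
  induction n with
  | zero => exact h
  | succ n ih => rw [Function.iterate_succ_apply'] at h; exact ih h.of_sortStep

/-- The number of rounds needed to sort an injective map of displacement at most `D`. -/
def sortTime (D : ℕ) : ℕ := (2 * ((2 * D + 1) + 2 * D + 1) + 1) ^ 2 + 1

theorem not_isDescent_sortStep_iterate {f : ℤ → ℤ} (hf : f.Injective) {D : ℕ}
    (hD : ∀ i, |f i - i| ≤ D) (c : ℤ) : ¬ IsDescent (sortStep^[sortTime D] f) c := by
  intro hc
  -- A descent surviving at `c` is an inversion of all earlier rounds. Its values are within `D + 1`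
  -- of `c`, so they sit within `2 * D + 1` of `c` in round `t`, with a descent between them.
  have near : ∀ t ≤ sortTime D,
      ∃ i, |i - c| ≤ 2 * D + 1 ∧ IsDescent (sortStep^[t] f) i := by
    intro t ht
    obtain ⟨s, hs⟩ := Nat.exists_eq_add_of_le ht
    have h1 := hc.isInversion
    have d0 := abs_le.1 (abs_sortStep_iterate_sub_le hD (sortTime D) c)
    have d1 := abs_le.1 (abs_sortStep_iterate_sub_le hD (sortTime D) (c + 1))
    generalize sortStep^[sortTime D] f c = b at *
    generalize ha : sortStep^[sortTime D] f (c + 1) = a at *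
    rw [hs, add_comm, Function.iterate_add_apply] at h1
    obtain ⟨i, j, rfl, rfl, hji, hlt⟩ := h1.of_sortStep_iterate
    obtain ⟨k, hk1, hk2, hk⟩ := exists_isDescent hji hlt
    have d2 := abs_le.1 (abs_sortStep_iterate_sub_le hD t i)
    have d3 := abs_le.1 (abs_sortStep_iterate_sub_le hD t j)
    exact ⟨k, abs_le.2 (by omega), hk⟩
  have count : ∀ t ≤ sortTime D,
      (inversionsNear (2 * D + 1 + 2 * D + 1) c (sortStep^[t] f)).ncard + t ≤
        (inversionsNear (2 * D + 1 + 2 * D + 1) c f).ncard := by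
    intro t
    induction t with
    | zero => intro _; simp
    | succ t ih =>
      intro ht
      obtain ⟨i, hi, hd⟩ := near t (by omega)
      have := ncard_inversionsNear_sortStep_lt (sortStep_iterate_injective hf t)
        (abs_sortStep_iterate_sub_le hD t) hi hd
      have := ih (by omega)
      rw [Function.iterate_succ_apply']
      omega
  have h1 := count _ le_rfl
  have h2 := ncard_inversionsNear_le (2 * D + 1 + 2 * D + 1) c f
  rw [show (2 * ((2 * (D : ℤ) + 1 + 2 * D + 1)) + 1).toNat =
    2 * ((2 * D + 1) + 2 * D + 1) + 1 by omega] at h2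
  unfold sortTime at h1
  omega

theorem eq_add_of_not_isDescent {f : ℤ → ℤ} (hf : f.Bijective) (h : ∀ i, ¬ IsDescent f i) (i : ℤ) :
    f i = f 0 + i := by
  have mono : StrictMono f := strictMono_int_of_lt_succ fun j =>
    lt_of_le_of_ne (not_lt.1 (h j)) (hf.1.ne (by omega))
  have succ : ∀ j, f (j + 1) = f j + 1 := by
    intro j
    -- Surjectivity excludes jumps larger than one.
    obtain ⟨k, hk⟩ := hf.2 (f j + 1)
    have h1 : j < k := mono.lt_iff_lt.1 (by omega)
    have h2 : f (j + 1) ≤ f k := mono.monotone h1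
    have h3 := mono (show j < j + 1 by omega)
    omega
  induction i with
  | zero => simp
  | succ i ih => rw [succ, ih, add_assoc]
  | pred i ih =>
    have := succ (-(i : ℤ) - 1)
    rw [sub_add_cancel] at this
    omega

/-! ### Control words -/

/-- The word `w(s) w(s + 1) ⋯ w(s + n - 1)`. -/
def wordAt {A : Type*} (w : ℤ → A) (s : ℤ) (n : ℕ) : List A := List.ofFn fun k : Fin n => w (s + k)

theorem matches_wordAt_iff {A : Type*} (w x : ℤ → A) (R : ℕ) (i : ℤ) :
    Matches (wordAt w (-R) R) (w 0) (wordAt w 1 R) x i ↔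
      ∀ u ∈ Finset.Icc (-R : ℤ) R, x (i + u) = w u := by
  have hw : wordAt w (-R) R ++ w 0 :: wordAt w 1 R = wordAt w (-R) (2 * R + 1) := by
    refine List.ext_getElem (by simp [wordAt]; omega) fun n h1 h2 => ?_
    simp only [wordAt, List.getElem_append, List.length_ofFn, List.getElem_ofFn, List.getElem_cons]
    split_ifs with h3 h4
    · rfl
    · congr 1; omega
    · congr 1; omega
  rw [Matches, hw]
  simp only [ReadsAt, wordAt, List.length_ofFn, List.get_eq_getElem, List.getElem_ofFn,
    Finset.mem_Icc]
  constructor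
  · intro h u hu
    have := h ⟨(u + R).toNat, by simp; omega⟩
    simp only [Int.toNat_of_nonneg (show 0 ≤ u + R by omega)] at this
    convert this using 2 <;> ring
  · intro h n
    have hn := n.2
    simp only [List.length_ofFn] at hn
    rw [← h (-R + (n : ℕ)) (by omega)]
    congr 1
    ring

/-! ### One-state automata as local displacements of the head -/

open SymbolicDynamics.FullShift

variable {A : Type*} [TopologicalSpace A] {X : Subshift A ℤ}

/-- `g x i` depends only on a bounded window of `x` around `i`, in a shift-invariant way. -/
def IsLocal {β : Type*} (g : X.carrier → ℤ → β) : Prop :=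
  ∃ R : ℕ, ∀ (x y : X.carrier) (i j : ℤ),
    (∀ u ∈ Finset.Icc (-R : ℤ) R, x.1 (i + u) = y.1 (j + u)) → g x i = g y j

theorem IsLocal.comp {β γ : Type*} {g : X.carrier → ℤ → β} (hg : IsLocal g) (φ : β → γ) :
    IsLocal fun x i => φ (g x i) := by
  obtain ⟨R, hR⟩ := hg
  exact ⟨R, fun x y i j h => congrArg φ (hR x y i j h)⟩

theorem IsLocal.prodMk {β γ : Type*} {g : X.carrier → ℤ → β} {g' : X.carrier → ℤ → γ}
    (hg : IsLocal g) (hg' : IsLocal g') : IsLocal fun x i => (g x i, g' x i) := by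
  obtain ⟨R, hR⟩ := hg
  obtain ⟨R', hR'⟩ := hg'
  refine ⟨max R R', fun x y i j h => Prod.ext (hR x y i j fun u hu => h u ?_)
    (hR' x y i j fun u hu => h u ?_)⟩ <;>
  · simp only [Finset.mem_Icc] at *
    push_cast
    omega

theorem IsLocal.translate {β : Type*} {g : X.carrier → ℤ → β} (hg : IsLocal g) (k : ℤ) :
    IsLocal fun x i => g x (i + k) := by
  obtain ⟨R, hR⟩ := hg
  refine ⟨R + k.natAbs, fun x y i j h => hR x y _ _ fun u hu => ?_⟩
  rw [add_assoc, add_assoc]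
  refine h _ ?_
  rw [Finset.mem_Icc] at *
  omega

/-- The head position after applying `T` to `x^i`. -/
def pos (T : Conf X 1 → Conf X 1) (x : X.carrier) (i : ℤ) : ℤ := (T (headAt x i)).2.2

theorem KeepsTape.apply_headAt {T : Conf X 1 → Conf X 1} (hT : KeepsTape T) (x : X.carrier)
    (i : ℤ) : T (headAt x i) = headAt x (pos T x i) :=
  Prod.ext (hT _) (Prod.ext (Subsingleton.elim _ _) rfl)

theorem eq_headAt (c : Conf X 1) : c = headAt c.1 c.2.2 :=
  Prod.ext rfl (Prod.ext (Subsingleton.elim _ _) rfl)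

theorem isMachine_of_isLocal {T : Conf X 1 → Conf X 1} (hT : KeepsTape T)
    (h : IsLocal fun x i => pos T x i - i) : IsMachine X 1 T := by
  classical
  obtain ⟨R, hR⟩ := h
  let Q (p : Finset.Icc (-R : ℤ) R → A) (z : X.carrier × ℤ) : Prop := ∀ u, z.1.1 (z.2 + u.1) = p u
  -- By locality any occurrence of `p` gives the same displacement; the value 0 serves patterns that
  -- never occur in `X`.
  let r (p : Finset.Icc (-R : ℤ) R → A) : ℤ :=
    if h : ∃ z, Q p z then pos T h.choose.1 h.choose.2 - h.choose.2 else 0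
  refine ⟨⟨Finset.Icc (-R : ℤ) R, ∅,
    fun p => (fun u => absurd u.2 (Finset.notMem_empty _), p.2, r p.1)⟩, fun c => ?_⟩
  obtain ⟨x, q, i⟩ := c
  obtain rfl : q = 0 := Subsingleton.elim _ _
  have hQ : ∃ z, Q (fun u => x.1 (i + u.1)) z := ⟨(x, i), fun _ => rfl⟩
  have hr : r (fun u => x.1 (i + u.1)) = pos T x i - i := by
    simp only [r, dif_pos hQ]
    exact hR _ _ _ _ fun u hu => hQ.choose_spec ⟨u, hu⟩
  have hT' := hT.apply_headAt x i
  change T (x, 0, i) = (x, 0, pos T x i) at hT'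
  rw [hT']
  simp [LocalRule.act, hr]

theorem pos_eq_of_act {T : Conf X 1 → Conf X 1} {f : LocalRule A 1}
    (hf : ∀ c : Conf X 1, (((T c).1 : ℤ → A), (T c).2) = f.act ((c.1 : ℤ → A), c.2))
    (x : X.carrier) (i : ℤ) :
    pos T x i - i = (f.rule (fun u => x.1 (i + u.1), 0)).2.2 := by
  have h := congrArg (fun p => p.2.2) (hf (headAt x i))
  simp only [LocalRule.act, headAt] at h
  rw [pos, headAt, h, add_sub_cancel_left]
  rfl

theorem IsMachine.isLocal {T : Conf X 1 → Conf X 1} (hT : IsMachine X 1 T) :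
    IsLocal fun x i => pos T x i - i := by
  obtain ⟨f, hf⟩ := hT
  refine ⟨f.inWindow.sup Int.natAbs, fun x y i j h => ?_⟩
  simp only [pos_eq_of_act hf]
  congr 4
  ext u
  refine h u ?_
  have := Finset.le_sup (f := Int.natAbs) u.2
  rw [Finset.mem_Icc]
  omega

theorem IsMachine.exists_abs_le [Finite A] {T : Conf X 1 → Conf X 1} (hT : IsMachine X 1 T) :
    ∃ D : ℕ, ∀ x i, |pos T x i - i| ≤ D := by
  obtain ⟨f, hf⟩ := hT
  obtain ⟨D, hD⟩ := (Set.finite_range fun p => (f.rule p).2.2.natAbs).bddAbove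
  refine ⟨D, fun x i => ?_⟩
  have := hD ⟨(fun u => x.1 (i + u.1), 0), rfl⟩
  rw [pos_eq_of_act hf, Int.abs_eq_natAbs]
  exact_mod_cast this

/-- The predicate `P` on positions of tapes is local, and never holds at two adjacent positions. -/
structure IsSwapControl (P : X.carrier → ℤ → Prop) : Prop where
  isLocal : IsLocal P
  not_succ : ∀ x i, P x i → ¬ P x (i + 1)

/-- The map exchanging the heads `x^i` and `x^{i+1}` whenever `P x i` holds. -/
noncomputable def swapFun (P : X.carrier → ℤ → Prop) (c : Conf X 1) : Conf X 1 :=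
  headAt c.1 (pairSwap (P c.1) c.2.2)

theorem swapFun_headAt (P : X.carrier → ℤ → Prop) (x : X.carrier) (i : ℤ) :
    swapFun P (headAt x i) = headAt x (pairSwap (P x) i) := rfl

theorem IsSwapControl.swapFun_involutive {P : X.carrier → ℤ → Prop} (hP : IsSwapControl P) :
    Function.Involutive (swapFun P) := fun c => by
  rw [eq_headAt c, swapFun_headAt, swapFun_headAt, pairSwap_involutive (hP.not_succ c.1)]

theorem IsSwapControl.isMachine_swapFun {P : X.carrier → ℤ → Prop} (hP : IsSwapControl P) :
    IsMachine X 1 (swapFun P) := by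
  classical
  refine isMachine_of_isLocal (fun _ => rfl) ?_
  convert (hP.isLocal.prodMk (hP.isLocal.translate (-1))).comp
    (fun p : Prop × Prop => if p.1 then (1 : ℤ) else if p.2 then -1 else 0) using 3 with x i
  change pairSwap (P x) i - i = _
  simp only [← sub_eq_add_neg]
  rcases pairSwap_cases (hP.not_succ x) i with ⟨h, e⟩ | ⟨h, e⟩ | ⟨h, h', e⟩
  · simp [e, h]
  · have : ¬ P x i := by simpa using hP.not_succ x _ h
    simp [e, h, this]
  · simp [e, h, h']

variable [Finite A]

/-- The element of `RFA X 1` exchanging `x^i` and `x^{i+1}` whenever `P x i` holds. -/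
noncomputable def IsSwapControl.swap {P : X.carrier → ℤ → Prop} (hP : IsSwapControl P) : RFA X 1 :=
  ⟨hP.swapFun_involutive.toPerm, ⟨hP.isMachine_swapFun, hP.isMachine_swapFun⟩, fun _ => rfl⟩

theorem IsSwapControl.swap_headAt {P : X.carrier → ℤ → Prop} (hP : IsSwapControl P)
    (x : X.carrier) (i : ℤ) : hP.swap.1 (headAt x i) = headAt x (pairSwap (P x) i) := rfl

theorem RFA.ext_headAt {S T : RFA X 1} (h : ∀ x i, S.1 (headAt x i) = T.1 (headAt x i)) :
    S = T :=
  Subtype.ext (Equiv.ext fun c => by rw [eq_headAt c, h])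

/-! ### Decomposing a swap into controlled position swaps -/

theorem IsSwapControl.isControlledPositionSwap {P : X.carrier → ℤ → Prop} (hP : IsSwapControl P)
    {w : ℤ → A} {R : ℕ}
    (h : ∀ x i, P x i ↔ ∀ u ∈ Finset.Icc (-R : ℤ) R, x.1 (i + u) = w u) :
    IsControlledPositionSwap hP.swap := by
  refine ⟨wordAt w (-R) R, w 0, wordAt w 1 R, fun x i => ?_⟩
  simp only [matches_wordAt_iff, ← h, hP.swap_headAt]
  exact ⟨fun h => by rw [pairSwap_of h, pairSwap_succ (hP.not_succ x) h]; exact ⟨rfl, rfl⟩,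
    fun h h' => by rw [pairSwap_of_not h h']⟩

theorem IsSwapControl.swap_mem_closure {P : X.carrier → ℤ → Prop} (hP : IsSwapControl P) :
    hP.swap ∈ Subgroup.closure {T : RFA X 1 | IsOrbitwiseShift T ∨ IsControlledPositionSwap T} := by
  classical
  have := Fintype.ofFinite A
  obtain ⟨R, hR⟩ := hP.isLocal
  let pat (x : X.carrier) (i : ℤ) : Finset.Icc (-R : ℤ) R → A := fun u => x.1 (i + u)
  have hpat : IsLocal pat := ⟨R, fun x y i j h => funext fun u => h u u.2⟩
  have hC : ∀ φ : (Finset.Icc (-R : ℤ) R → A) → Prop,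
      IsSwapControl fun x i => P x i ∧ φ (pat x i) := fun φ =>
    ⟨(hP.isLocal.prodMk hpat).comp fun p => p.1 ∧ φ p.2, fun x i h h' => hP.not_succ x i h.1 h'.1⟩
  have key : ∀ s : Finset (Finset.Icc (-R : ℤ) R → A), (hC (· ∈ s)).swap ∈
      Subgroup.closure {T : RFA X 1 | IsOrbitwiseShift T ∨ IsControlledPositionSwap T} := by
    intro s
    induction s using Finset.induction_on with
    | empty =>
      convert Subgroup.one_mem _
      refine RFA.ext_headAt fun x i => ?_
      rw [IsSwapControl.swap_headAt, pairSwap_of_not (by simp) (by simp)]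
      rfl
    | insert w s hw ih =>
      -- Since `P` never holds at adjacent positions and `w ∉ s`, the two factors move disjoint sets
      -- of heads.
      have hmul : (hC (· ∈ insert w s)).swap = (hC (· = w)).swap * (hC (· ∈ s)).swap := by
        refine RFA.ext_headAt fun x i => ?_
        change _ = (hC (· = w)).swap.1 ((hC (· ∈ s)).swap.1 (headAt x i))
        simp only [IsSwapControl.swap_headAt]
        congr 1
        have h0 := hP.not_succ x i
        have h2 := hP.not_succ x (i - 1 - 1)
        simp only [sub_add_cancel] at h2
        rcases pairSwap_cases ((hC (· ∈ s)).not_succ x) i with ⟨h, e⟩ | ⟨h, e⟩ | ⟨h, h', e⟩ <;>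
          rw [e]
        · have hne : pat x i ≠ w := fun hc => hw (hc ▸ h.2)
          rw [pairSwap_of ⟨h.1, Finset.mem_insert_of_mem h.2⟩,
            pairSwap_of_not (fun hc => h0 h.1 hc.1) (by simpa using fun _ => hne)]
        · have hne : pat x (i - 1) ≠ w := fun hc => hw (hc ▸ h.2)
          rw [pairSwap_of_not (P := fun i => P x i ∧ pat x i = w) (fun hc => hne hc.2)
            (fun hc => h2 hc.1 h.1)]
          have := pairSwap_succ ((hC (· ∈ insert w s)).not_succ x)
            ⟨h.1, Finset.mem_insert_of_mem h.2⟩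
          rwa [sub_add_cancel] at this
        · have e1 : ∀ j, ¬ (P x j ∧ pat x j ∈ s) →
              ((P x j ∧ pat x j ∈ insert w s) ↔ (P x j ∧ pat x j = w)) := by
            intro j hj
            rw [Finset.mem_insert]
            tauto
          exact pairSwap_congr (e1 i h) (e1 (i - 1) h')
      rw [hmul]
      refine Subgroup.mul_mem _ ?_ ih
      -- If `w` occurs once with `P` true, locality makes `P` true at every occurrence of `w`, so
      -- the control is exactly the word `w`. Otherwise the swap is trivial.
      by_cases hex : ∃ x i, P x i ∧ pat x i = w
      · obtain ⟨x, i, hx, rfl⟩ := hex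
        refine Subgroup.subset_closure (.inr ?_)
        refine (hC (· = pat x i)).isControlledPositionSwap (w := fun u => x.1 (i + u)) (R := R)
          fun y j => ⟨fun h u hu => congrFun h.2 ⟨u, hu⟩, fun h => ⟨?_, funext fun u => h u u.2⟩⟩
        rwa [hR y x j i h]
      · convert Subgroup.one_mem _
        push Not at hex
        refine RFA.ext_headAt fun x i => ?_
        rw [IsSwapControl.swap_headAt,
          pairSwap_of_not (fun h => hex _ _ h.1 h.2) (fun h => hex _ _ h.1 h.2)]
        rfl
  have huniv := key Finset.univ
  convert huniv using 1
  exact RFA.ext_headAt fun x i => by simp [IsSwapControl.swap_headAt]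

/-! ### Sorting an automaton -/

theorem RFA.apply_headAt (T : RFA X 1) (x : X.carrier) (i : ℤ) :
    T.1 (headAt x i) = headAt x (pos T.1 x i) := KeepsTape.apply_headAt T.2.2 x i

theorem RFA.pos_bijective (T : RFA X 1) (x : X.carrier) : (pos T.1 x).Bijective := by
  have inv : ∀ (S T : RFA X 1), S * T = 1 → ∀ i, pos S.1 x (pos T.1 x i) = i := by
    intro S T h i
    have h1 : S.1 (T.1 (headAt x i)) = headAt x i := by
      change (S * T).1 (headAt x i) = _
      rw [h]; rfl
    rw [RFA.apply_headAt, RFA.apply_headAt] at h1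
    exact congrArg (fun c => c.2.2) h1
  exact ⟨(show Function.LeftInverse (pos T⁻¹.1 x) (pos T.1 x) from
      inv _ _ (inv_mul_cancel T)).injective,
    (show Function.RightInverse (pos T⁻¹.1 x) (pos T.1 x) from
      inv _ _ (mul_inv_cancel T)).surjective⟩

theorem RFA.isSwapControl_isRunStart (T : RFA X 1) :
    IsSwapControl fun x i => IsRunStart (pos T.1 x) i := by
  refine ⟨?_, fun x => IsRunStart.not_succ⟩
  have h := T.2.1.1.isLocal
  -- Only displacements are local, so descents are rewritten through them: with `d i = f i - i`, `f
  -- (i + 1) < f i` means `d (i + 1) + 1 < d i`.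
  convert (h.prodMk ((h.translate 1).prodMk (h.translate (-1)))).comp
    (fun p : ℤ × ℤ × ℤ => p.2.1 + 1 < p.1 ∧ ¬ (p.1 + 1 < p.2.2)) using 3 with x i
  simp only [IsRunStart, IsDescent, sub_add_cancel, ← sub_eq_add_neg]
  refine and_congr ?_ (not_congr ?_) <;> omega

/-- One round of sorting applied to an automaton. -/
noncomputable def RFA.sort (T : RFA X 1) : RFA X 1 := T * (RFA.isSwapControl_isRunStart T).swap

theorem RFA.pos_sort (T : RFA X 1) (x : X.carrier) : pos (RFA.sort T).1 x = sortStep (pos T.1 x) := rfl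

theorem RFA.pos_sort_iterate (T : RFA X 1) (n : ℕ) (x : X.carrier) :
    pos (RFA.sort^[n] T).1 x = sortStep^[n] (pos T.1 x) := by
  induction n with
  | zero => rfl
  | succ n ih => rw [Function.iterate_succ_apply', Function.iterate_succ_apply', RFA.pos_sort, ih]

theorem RFA.mem_closure_of_sort_iterate (T : RFA X 1) (n : ℕ)
    (h : RFA.sort^[n] T ∈
      Subgroup.closure {T : RFA X 1 | IsOrbitwiseShift T ∨ IsControlledPositionSwap T}) :
    T ∈ Subgroup.closure {T : RFA X 1 | IsOrbitwiseShift T ∨ IsControlledPositionSwap T} := by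
  induction n with
  | zero => exact h
  | succ n ih =>
    rw [Function.iterate_succ_apply'] at h
    exact ih ((Subgroup.mul_mem_cancel_right _
      (RFA.isSwapControl_isRunStart (RFA.sort^[n] T)).swap_mem_closure).1 h)

theorem RFA.exists_isOrbitwiseShift_sort_iterate (T : RFA X 1) :
    ∃ n, IsOrbitwiseShift (RFA.sort^[n] T) := by
  obtain ⟨D, hD⟩ := T.2.1.1.exists_abs_le
  refine ⟨sortTime D, fun x => ⟨-pos (RFA.sort^[sortTime D] T).1 x 0, fun i => ?_⟩⟩
  have hd : ∀ j, ¬ IsDescent (pos (RFA.sort^[sortTime D] T).1 x) j := by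
    rw [RFA.pos_sort_iterate]
    exact not_isDescent_sortStep_iterate (RFA.pos_bijective T x).1 (hD x)
  rw [RFA.apply_headAt, eq_add_of_not_isDescent (RFA.pos_bijective _ x) hd i]
  congr 1
  ring

end MovingHead

theorem mainTheorem10 {A : Type*} [Finite A] [TopologicalSpace A] [DiscreteTopology A]
    (X : SymbolicDynamics.FullShift.Subshift A ℤ) :
    Subgroup.closure
      {T : MovingHead.RFA X 1 |
        MovingHead.IsOrbitwiseShift T ∨ MovingHead.IsControlledPositionSwap T} = ⊤ := by
  rw [Subgroup.eq_top_iff']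
  intro T
  obtain ⟨n, hn⟩ := MovingHead.RFA.exists_isOrbitwiseShift_sort_iterate T
  exact MovingHead.RFA.mem_closure_of_sort_iterate T n (Subgroup.subset_closure (.inl hn))
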